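/- Let $T>0$, $d\in\mathbb N$, $\frac14<H<\frac12$, and let $B=(B^1,\dots,B^d)$ be a $d$-dimensional fractional Brownian motion on $[0,T]$ with Hurst parameter $H$, i.e. a continuous centered Gaussian process with $$\mathbb E[B^i_tB^j_s]=\tfrac12\big(t^{2H}+s^{2H}-|t-s|^{2H}\big)\mathbf 1_{\{i=j\}},\qquad s,t\in[0,T],\ i,j=1,\dots,d.$$ For an integer $n\ge1$ put $h=T/n$, $t_k=kh$ and $\Delta B^i_{k+1}=B^i_{t_{k+1}}-B^i_{t_k}$. For a multi-index $\alpha=(\alpha_1,\dots,\alpha_d)$ of non-negative integers with $|\alpha|=\alpha_1+\dots+\alpha_d$, let $\tilde x^{n,\alpha}$ be the real-valued piecewise linear process on $[0,T]$, with arbitrary initial value $\tilde x^{n,\alpha}_0$, such that $$\tilde x^{n,\alpha}_t=\tilde x^{n,\alpha}_{t_k}+(t-t_k)h^{-1}(\Delta B^1_{k+1})^{\alpha_1}\cdots(\Delta B^d_{k+1})^{\alpha_d},\qquad t\in(t_k,t_{k+1}],\ k=0,\dots,n-1.$$ Then for all $0<\delta<\frac12$ and $0<\epsilon<3H-\frac12$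 there exists a positive (finite) random variable $G=G(\delta,\epsilon)$, independent of $n$ (equivalently, of $h$) and of $\alpha$, such that, almost surely, for all $n\ge1$ and all $\alpha$ with $|\alpha|=3$, $$\sup_{0\le s<t\le T}\frac{\big|\tilde x^{n,\alpha}_t-\tilde x^{n,\alpha}_s\big|}{|t-s|^{\frac12-\delta}}\le G\,h^{3H-\frac12-\epsilon}.$$ -/

import Mathlib

open MeasureTheory ProbabilityTheory

open scoped ENNReal

namespace RoughMilstein

/-- `B` is, on the time interval `[0, T]`, a `d`-dimensional fractional Brownian motion with Hurst
parameter `H` under `P`: an almost surely continuous centered Gaussian process with covariance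
`E[B^i_t B^j_s] = (t^{2H} + s^{2H} - |t - s|^{2H}) / 2` if `i = j`, and `0` otherwise.
The values of `B` at times outside `[0, T]` play no role. -/
structure IsFBM {Ω : Type*} [MeasurableSpace Ω] {d : ℕ} (H T : ℝ)
    (B : ℝ → Ω → EuclideanSpace ℝ (Fin d)) (P : Measure Ω) : Prop where
  gaussian : IsGaussianProcess (fun t : Set.Icc (0 : ℝ) T ↦ B t) P
  continuous_paths : ∀ᵐ ω ∂P, ContinuousOn (fun t ↦ B t ω) (Set.Icc 0 T)
  centered : ∀ t ∈ Set.Icc (0 : ℝ) T, ∀ i, ∫ ω, B t ω i ∂P = 0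
  covariance : ∀ t ∈ Set.Icc (0 : ℝ) T, ∀ s ∈ Set.Icc (0 : ℝ) T, ∀ i j,
    ∫ ω, B t ω i * B s ω j ∂P =
      if i = j then (t ^ (2 * H) + s ^ (2 * H) - |t - s| ^ (2 * H)) / 2 else 0

/-- The step size `h = T / n`. -/
noncomputable def stepSize (T : ℝ) (n : ℕ) : ℝ := T / n

/-- The grid point `t_k = k h`. -/
noncomputable def gridPoint (T : ℝ) (n k : ℕ) : ℝ := k * stepSize T n

/-- For a path `b`, the monomial `∏ i, (b^i_{t_{k+1}} - b^i_{t_k}) ^ α_i` of the increment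
`Δb_{k+1}`. -/
noncomputable def incrMonomial {d : ℕ} (T : ℝ) (n : ℕ) (b : ℝ → EuclideanSpace ℝ (Fin d))
    (α : Fin d → ℕ) (k : ℕ) : ℝ :=
  ∏ i, (b (gridPoint T n (k + 1)) i - b (gridPoint T n k) i) ^ α i

/-- The piecewise linear path with initial value `x₀` that runs linearly through the increment
`incrMonomial T n b α k` on the step `(t_k, t_{k+1}]`. The index of the step that contains
`t > 0` is `⌈t / h⌉₊ - 1`; at `t = 0` this expression is `0` and the value is `x₀`. -/
noncomputable def monomialPath {d : ℕ} (T : ℝ) (n : ℕ) (b : ℝ → EuclideanSpace ℝ (Fin d))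
    (α : Fin d → ℕ) (x₀ : ℝ) (t : ℝ) : ℝ :=
  let k : ℕ := ⌈t / stepSize T n⌉₊ - 1
  x₀ + ∑ l ∈ Finset.range k, incrMonomial T n b α l
    + (t - gridPoint T n k) * (stepSize T n)⁻¹ * incrMonomial T n b α k

theorem monomialPath_zero {d : ℕ} (T : ℝ) (n : ℕ) (b : ℝ → EuclideanSpace ℝ (Fin d))
    (α : Fin d → ℕ) (x₀ : ℝ) : monomialPath T n b α x₀ 0 = x₀ := by
  simp [monomialPath, gridPoint]

/-- The value at a grid point is the initial value plus the sum of the preceding increments. -/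
theorem monomialPath_gridPoint {d : ℕ} {T : ℝ} (hT : 0 < T) {n : ℕ} (hn : 1 ≤ n)
    (b : ℝ → EuclideanSpace ℝ (Fin d)) (α : Fin d → ℕ) (x₀ : ℝ) (k : ℕ) :
    monomialPath T n b α x₀ (gridPoint T n k)
      = x₀ + ∑ l ∈ Finset.range k, incrMonomial T n b α l := by
  have hh : 0 < stepSize T n := div_pos hT (by exact_mod_cast hn)
  have hq : gridPoint T n k / stepSize T n = (k : ℝ) := by
    unfold gridPoint
    field_simp
  cases k with
  | zero => simp [monomialPath, gridPoint]
  | succ m =>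
    have hc : ⌈gridPoint T n (m + 1) / stepSize T n⌉₊ - 1 = m := by
      rw [hq, Nat.ceil_natCast]; rfl
    simp only [monomialPath, hc, Finset.sum_range_succ]
    have : (gridPoint T n (m + 1) - gridPoint T n m) * (stepSize T n)⁻¹ = 1 := by
      unfold gridPoint
      push_cast
      field_simp
      ring
    rw [this]
    ring

/-- The defining recursion of the piecewise linear path. -/
theorem monomialPath_eq {d : ℕ} {T : ℝ} (hT : 0 < T) {n : ℕ} (hn : 1 ≤ n)
    (b : ℝ → EuclideanSpace ℝ (Fin d)) (α : Fin d → ℕ) (x₀ : ℝ) (k : ℕ) (t : ℝ)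
    (ht : t ∈ Set.Ioc (gridPoint T n k) (gridPoint T n (k + 1))) :
    monomialPath T n b α x₀ t = monomialPath T n b α x₀ (gridPoint T n k)
      + (t - gridPoint T n k) * (stepSize T n)⁻¹ * incrMonomial T n b α k := by
  have hh : 0 < stepSize T n := div_pos hT (by exact_mod_cast hn)
  have hc : ⌈t / stepSize T n⌉₊ = k + 1 := by
    rw [Nat.ceil_eq_iff (by omega)]
    obtain ⟨h1, h2⟩ := ht
    unfold gridPoint at h1 h2
    constructor
    · rw [lt_div_iff₀ hh]
      simpa using h1
    · rw [div_le_iff₀ hh]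
      exact h2
  rw [monomialPath_gridPoint hT hn]
  simp only [monomialPath, hc, Nat.add_sub_cancel]

/-- The `β`-Hölder seminorm `sup_{0 ≤ s < t ≤ T} |x_t - x_s| / |t - s|^β`, with values in
`[0, ∞]`. -/
noncomputable def holderSeminorm (T β : ℝ) (x : ℝ → ℝ) : ℝ≥0∞ :=
  ⨆ (s : ℝ) (t : ℝ) (_ : 0 ≤ s) (_ : s < t) (_ : t ≤ T),
    ENNReal.ofReal (|x t - x s| / |t - s| ^ β)

end RoughMilstein

/-!
# Hölder bounds for the piecewise linear paths of third-order monomials of fractional Brownian motion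

A third-order monomial of the increments of `B` over a step of length `h` has size `h ^ (3H)`. The
sum of `N` consecutive ones has the size `h ^ (3H) * √N` of a random walk, and not `h ^ (3H) * N`,
for two reasons: the increments of `B` are weakly correlated, and the number three of factors is
odd.

* *Weak correlation.* The covariance of two increments of the same coordinate over steps at
  distance `r` is `h ^ (2H)` times a second difference of `x ↦ x ^ (2H)`. For `H < 1 / 2` this
  function is concave, so that the absolute values of the second differences telescope and are
  summable over `r` (`sum_noiseKernel_dist_le`).
* *Odd number of factors.* The moment of order `2m` of the sum is a sum, over the indices of `2m`
  vertices, of expectations of products of `6m` jointly Gaussian variables, three at each vertex.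
  Gaussian integration by parts (`integral_mul_prod_of_isGaussianProcess`) removes the variables in
  pairs, each pair contributing a covariance. Pairs inside a vertex do not change the parity of the
  number of variables left there, so every vertex is joined to another one at some point. The
  summation over the index of a newly joined vertex then costs a constant in place of a factor `N`.
  Since a pair joins at most two new vertices, the gain is at least `√N` per vertex. Carrying the
  covariances produced so far as a weight, this is an induction on the number of variables
  (`sum_mul_abs_integral_prod_le`), and no enumeration of pairings is needed. The outcome is a
  moment of order `h ^ (6Hm) * N ^ m` (`integral_sum_prod_three_pow_le`,
  `IsFBM.moment_sum_incr_le`).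

Divide the sum over a block of `N` steps by `(N h) ^ (1/2 - δ) * h ^ (3H - 1/2 - ε)`. By the moment
bound, the moment of order `2m` of the quotient is at most a constant times
`((N h) ^ δ * h ^ ε) ^ (2m)`, hence of order `n ^ (-2mε)`. There are of order `n ^ 2` blocks in the
grid with `n` steps, so that for `2mε ≥ 4` these moments are summable over all blocks of all grids,
and the sum of the `2m`-th powers of the quotients is an almost surely finite random variable, which
dominates all of them (`IsFBM.exists_bound_sum_incr`). Finally, a Hölder bound at the grid points
passes to the piecewise linear path (`holderSeminorm_monomialPath_le`).
-/

namespace RoughMilstein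

/-! ### Gaussian integration by parts -/

open Polynomial in
theorem integrable_eval_gaussianReal (v : NNReal) (p : ℝ[X]) :
    Integrable (fun x ↦ p.eval x) (gaussianReal 0 v) := by
  induction p using Polynomial.induction_on' with
  | add p q hp hq =>
    simp only [Polynomial.eval_add]
    exact hp.add hq
  | monomial n a =>
    simp only [Polynomial.eval_monomial]
    refine Integrable.const_mul ?_ a
    have := (memLp_id_gaussianReal' (μ := 0) (v := v) n (by simp)).integrable_norm_pow'
    refine (integrable_norm_iff (by fun_prop)).1 ?_
    simpa using this

open Polynomial in
/-- Gaussian integration by parts in one variable, for polynomials. -/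
theorem integral_mul_eval_gaussianReal (v : NNReal) (p : ℝ[X]) :
    ∫ x, x * p.eval x ∂(gaussianReal 0 v) = v * ∫ x, p.derivative.eval x ∂(gaussianReal 0 v) := by
  by_cases hv : v = 0
  · simp [hv]
  have hint (q : ℝ[X]) : Integrable (fun x ↦ q.eval x * gaussianPDFReal 0 v x) := by
    have := integrable_eval_gaussianReal v q
    rw [gaussianReal_of_var_ne_zero _ hv, integrable_withDensity_iff_integrable_smul'
      (measurable_gaussianPDF _ _) (.of_forall fun _ ↦ gaussianPDF_lt_top)] at this
    simpa [toReal_gaussianPDF, mul_comm] using this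
  have hder (x : ℝ) : HasDerivAt (gaussianPDFReal 0 v)
      (-(x / v) * gaussianPDFReal 0 v x) x := by
    have hv' : (v : ℝ) ≠ 0 := by exact_mod_cast hv
    have h1 : HasDerivAt (fun x : ℝ ↦ -(x - 0) ^ 2 / (2 * v)) (-(x / v)) x := by
      have := (((hasDerivAt_id' x).sub_const 0).pow 2).neg.div_const (2 * (v : ℝ))
      refine this.congr_deriv ?_
      simp only [sub_zero, Nat.cast_ofNat, Nat.add_one_sub_one, pow_one]
      field_simp
    refine (h1.exp.const_mul _).congr_deriv ?_
    rw [gaussianPDFReal]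
    ring
  have key := integral_mul_deriv_eq_deriv_mul_of_integrable (u := fun x ↦ p.eval x)
    (u' := fun x ↦ p.derivative.eval x) (v := gaussianPDFReal 0 v)
    (v' := fun x ↦ -(x / v) * gaussianPDFReal 0 v x)
    (fun x _ ↦ p.hasDerivAt x) (fun x _ ↦ hder x)
    (by
      refine ((hint (X * p)).const_mul (-(v : ℝ)⁻¹)).congr (.of_forall fun x ↦ ?_)
      simp
      ring)
    (hint _) (hint _)
  rw [integral_gaussianReal_eq_integral_smul hv, integral_gaussianReal_eq_integral_smul hv]
  have hv' : (v : ℝ) ≠ 0 := by exact_mod_cast hv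
  calc ∫ x, gaussianPDFReal 0 v x • (x * p.eval x)
      = ∫ x, -(v : ℝ) * (p.eval x * (-(x / v) * gaussianPDFReal 0 v x)) := by
        refine integral_congr_ae (.of_forall fun x ↦ ?_)
        simp only [smul_eq_mul]
        field_simp
    _ = v * ∫ x, p.derivative.eval x * gaussianPDFReal 0 v x := by
        rw [integral_const_mul, key]
        ring
    _ = _ := by simp [mul_comm]

theorem integral_mul_prod_gaussianReal {A : Type*} [DecidableEq A] (v : NNReal) (s : Finset A)
    (c z : A → ℝ) :
    ∫ x, x * ∏ b ∈ s, (c b * x + z b) ∂(gaussianReal 0 v)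
      = v * ∫ x, ∑ b ∈ s, c b * ∏ b' ∈ s.erase b, (c b' * x + z b') ∂(gaussianReal 0 v) := by
  have := integral_mul_eval_gaussianReal v
    (∏ b ∈ s, (Polynomial.C (c b) * Polynomial.X + Polynomial.C (z b)))
  rw [Polynomial.derivative_prod_finset] at this
  simpa [Polynomial.eval_prod, Polynomial.eval_finsetSum, mul_comm (c _)] using this

/-- Products of coordinates of a Gaussian process have moments of all orders. -/
theorem memLp_prod_of_isGaussianProcess {Ω ι A : Type*} [MeasurableSpace Ω] {P : Measure Ω}
    {W : ι → Ω → ℝ} (hW : IsGaussianProcess W P) (f : A → ι) (s : Finset A) (p : ℝ≥0∞)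
    (hp : p ≠ ∞) : MemLp (fun ω ↦ ∏ b ∈ s, W (f b) ω) p P := by
  have := hW.isProbabilityMeasure
  classical
  induction s using Finset.induction_on generalizing p with
  | empty => simpa using memLp_const (1 : ℝ)
  | insert a s ha ih =>
    simp only [Finset.prod_insert ha]
    have h2 : p * 2 ≠ ∞ := by finiteness
    have : ENNReal.HolderTriple (p * 2) (p * 2) p := by
      constructor
      rcases eq_or_ne p 0 with rfl | h0
      · simp
      rw [ENNReal.mul_inv (by simp) (by simp), ← mul_add, ENNReal.inv_two_add_inv_two, mul_one]
    exact (ih _ h2).mul' ((hW.hasGaussianLaw_eval (f a)).memLp h2)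

theorem integrable_prod_of_isGaussianProcess {Ω ι A : Type*} [MeasurableSpace Ω] {P : Measure Ω}
    {W : ι → Ω → ℝ} (hW : IsGaussianProcess W P) (f : A → ι) (s : Finset A) :
    Integrable (fun ω ↦ ∏ b ∈ s, W (f b) ω) P :=
  memLp_one_iff_integrable.1 (memLp_prod_of_isGaussianProcess hW f s 1 (by simp))

/-- Gaussian integration by parts: pairing off one factor of a product of centered jointly Gaussian
variables. Each `W (f b)` is split as `c b * W a + Z b` with `Z` independent of `W a`; the formula
then holds conditionally on `Z`. -/
theorem integral_mul_prod_of_isGaussianProcess {Ω ι A : Type*} [MeasurableSpace Ω] {P : Measure Ω}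
    [Countable A] [DecidableEq A]
    {W : ι → Ω → ℝ} (hW : IsGaussianProcess W P) (h0 : ∀ i, ∫ ω, W i ω ∂P = 0) (a : ι) (f : A → ι)
    (s : Finset A) :
    ∫ ω, W a ω * ∏ b ∈ s, W (f b) ω ∂P
      = ∑ b ∈ s, (∫ ω, W a ω * W (f b) ω ∂P) * ∫ ω, ∏ b' ∈ s.erase b, W (f b') ω ∂P := by
  have := hW.isProbabilityMeasure
  have hL2 (i : ι) : MemLp (W i) 2 P := (hW.hasGaussianLaw_eval i).memLp_two
  set v : ℝ := Var[W a; P] with hv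
  have hv0 : 0 ≤ v := variance_nonneg _ _
  set c : A → ℝ := fun b ↦ cov[W a, W (f b); P] / v with hc
  have hcov (i j : ι) : cov[W i, W j; P] = ∫ ω, W i ω * W j ω ∂P := by
    rw [covariance_eq_sub (hL2 i) (hL2 j)]
    simp [h0]
  have hcv (b : A) : c b * v = cov[W a, W (f b); P] := by
    rcases eq_or_ne v 0 with hv1 | hv1
    · have h1 : W a =ᵐ[P] fun _ ↦ 0 := by
        have := ae_eq_integral_of_variance_eq_zero (hL2 a) hv1
        rwa [h0] at this
      rw [hv1, mul_zero, hcov]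
      symm
      rw [← integral_zero Ω ℝ (μ := P)]
      refine integral_congr_ae ?_
      filter_upwards [h1] with ω h
      simp [h]
    · simp [hc, hv1]
  set Z : A → Ω → ℝ := fun b ω ↦ W (f b) ω - c b * W a ω with hZ
  have hWZ (b : A) (ω : Ω) : W (f b) ω = c b * W a ω + Z b ω := by simp [hZ]
  have hG : IsGaussianProcess (Sum.elim (fun _ : Unit ↦ W a) Z) P := by
    classical
    refine hW.of_isGaussianProcess fun t ↦ ?_
    rcases t with u | b
    · exact ⟨{a}, .proj ⟨a, by simp⟩, fun ω ↦ by simp⟩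
    · refine ⟨{a, f b}, .proj ⟨f b, by simp⟩ - c b • .proj ⟨a, by simp⟩, fun ω ↦ by simp [hZ]⟩
  have hma := hW.aemeasurable a
  have hmZ (b : A) : AEMeasurable (Z b) P := hG.aemeasurable (Sum.inr b)
  have hind : IndepFun (fun ω (_ : Unit) ↦ W a ω) (fun ω b ↦ Z b ω) P := by
    refine hG.indepFun_of_covariance_eq_zero (fun _ ↦ hma) hmZ fun _ b ↦ ?_
    have : Z b = W (f b) - c b • W a := rfl
    rw [this, covariance_sub_right (hL2 _) (hL2 _) ((hL2 _).const_smul _), covariance_smul_right,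
      covariance_self hma, ← hv, hcv]
    ring
  have hmZ' : AEMeasurable (fun ω b ↦ Z b ω) P := aemeasurable_pi_iff.2 hmZ
  have hind' : IndepFun (W a) (fun ω b ↦ Z b ω) P :=
    hind.comp (measurable_pi_apply ()) measurable_id
  set ν := P.map (fun ω b ↦ Z b ω)
  have hlaw : P.map (fun ω ↦ (W a ω, fun b ↦ Z b ω)) = (gaussianReal 0 v.toNNReal).prod ν := by
    rw [(indepFun_iff_map_prod_eq_prod_map_map hma hmZ').1 hind',
      (hW.hasGaussianLaw_eval a).map_eq_gaussianReal, h0]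
  have hmp : AEMeasurable (fun ω ↦ (W a ω, fun b ↦ Z b ω)) P := hma.prodMk hmZ'
  have hν : IsProbabilityMeasure ν := Measure.isProbabilityMeasure_map hmZ'
  -- transfer of an integral to the product law of `(W a, Z)`, integrating out `W a` first
  have fubini (F : ℝ × (A → ℝ) → ℝ) (hF : Measurable F)
      (hFi : Integrable (fun ω ↦ F (W a ω, fun b ↦ Z b ω)) P) :
      ∫ ω, F (W a ω, fun b ↦ Z b ω) ∂P
        = ∫ z, ∫ x, F (x, z) ∂(gaussianReal 0 v.toNNReal) ∂ν := by
    rw [← integral_map (φ := fun ω ↦ (W a ω, fun b ↦ Z b ω)) hmp hF.aestronglyMeasurable, hlaw,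
      integral_prod_symm]
    rw [← hlaw]
    exact (integrable_map_measure hF.aestronglyMeasurable hmp).2 hFi
  have hi1 : Integrable (fun ω ↦ W a ω * ∏ b ∈ s, (c b * W a ω + Z b ω)) P := by
    simp only [← hWZ]
    exact (hL2 a).integrable_mul (memLp_prod_of_isGaussianProcess hW f s 2 (by simp))
  have hi2 : Integrable
      (fun ω ↦ ∑ b ∈ s, c b * ∏ b' ∈ s.erase b, (c b' * W a ω + Z b' ω)) P := by
    simp only [← hWZ]
    exact integrable_finsetSum _ fun b _ ↦
      (integrable_prod_of_isGaussianProcess hW f _).const_mul _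
  calc ∫ ω, W a ω * ∏ b ∈ s, W (f b) ω ∂P
      = ∫ ω, W a ω * ∏ b ∈ s, (c b * W a ω + Z b ω) ∂P := by simp only [← hWZ]
    _ = ∫ z, ∫ x, x * ∏ b ∈ s, (c b * x + z b) ∂(gaussianReal 0 v.toNNReal) ∂ν :=
        fubini (fun q ↦ q.1 * ∏ b ∈ s, (c b * q.1 + q.2 b)) (by fun_prop) hi1
    _ = v * ∫ z, ∫ x, ∑ b ∈ s, c b * ∏ b' ∈ s.erase b, (c b' * x + z b')
          ∂(gaussianReal 0 v.toNNReal) ∂ν := by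
        rw [← integral_const_mul]
        refine integral_congr_ae (.of_forall fun z ↦ ?_)
        simp only [integral_mul_prod_gaussianReal, Real.coe_toNNReal _ hv0]
    _ = v * ∫ ω, ∑ b ∈ s, c b * ∏ b' ∈ s.erase b, W (f b') ω ∂P := by
        rw [← fubini (fun q ↦ ∑ b ∈ s, c b * ∏ b' ∈ s.erase b, (c b' * q.1 + q.2 b'))
          (by fun_prop) hi2]
        simp only [← hWZ]
    _ = _ := by
        rw [integral_finsetSum _ fun b _ ↦
          (integrable_prod_of_isGaussianProcess hW f _).const_mul _, Finset.mul_sum]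
        refine Finset.sum_congr rfl fun b _ ↦ ?_
        rw [integral_const_mul, ← hcov, ← hcv]
        ring

/-! ### Moments of sums of products of three Gaussian variables -/

section Counting

variable {V : Type*} [Fintype V] [DecidableEq V] {N : ℕ}

theorem sum_sum_update (u : V) (F : (V → Fin N) → ℝ) :
    ∑ j, ∑ x, F (Function.update j u x) = N * ∑ j, F j := by
  let e : (V → Fin N) × Fin N → (V → Fin N) × Fin N := fun q ↦ (Function.update q.1 u q.2, q.1 u)
  have he : Function.Involutive e := fun q ↦ by simp [e]
  have := Equiv.sum_comp he.toPerm (fun q ↦ F q.1)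
  simp only [Fintype.sum_prod_type] at this
  rw [Finset.mul_sum]
  simpa [e] using this

/-- Summing out the index of a vertex on which the weight `Φ` does not depend gains a factor
`C / N`. -/
theorem sum_mul_kernel_le {Φ : (V → Fin N) → ℝ} (hΦ : ∀ j, 0 ≤ Φ j) {u : V}
    (hu : ∀ j x, Φ (Function.update j u x) = Φ j) {v : V} (huv : u ≠ v)
    {w : Fin N → Fin N → ℝ} {C : ℝ} (hC : ∀ y, ∑ x, w x y ≤ C) (hN : 0 < N) :
    ∑ j, Φ j * w (j u) (j v) ≤ C / N * ∑ j, Φ j := by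
  have hN' : (0 : ℝ) < N := by exact_mod_cast hN
  have h : (N : ℝ) * ∑ j, Φ j * w (j u) (j v) ≤ C * ∑ j, Φ j := by
    rw [← sum_sum_update u, Finset.mul_sum]
    refine Finset.sum_le_sum fun j _ ↦ ?_
    simp only [hu, Function.update_self, Function.update_of_ne huv.symm, ← Finset.mul_sum]
    rw [mul_comm C]
    exact mul_le_mul_of_nonneg_left (hC _) (hΦ j)
  rw [div_mul_eq_mul_div, le_div_iff₀ hN']
  linarith

/-- The inductive form of the moment bound. A finite set `s` of half-edges is distributed over the
vertices in `V`, and the half-edge `a` at a vertex with index `x` carries the Gaussian variable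
`W (g a x)`. The weight `Φ` collects the covariances of the half-edges that are paired already; it
depends only on the indices of the vertices in `U`. Every other vertex has an odd number of
half-edges left, so that it cannot be exhausted by pairings inside it: it will be joined to another
vertex, and then the summation over its index gains a factor. -/
theorem sum_mul_abs_integral_prod_le {Ω ι A : Type*} [MeasurableSpace Ω] {P : Measure Ω}
    [Countable A] [DecidableEq A] {W : ι → Ω → ℝ} (hW : IsGaussianProcess W P)
    (h0 : ∀ i, ∫ ω, W i ω ∂P = 0) (hN : 0 < N) (v : A → V) (g : A → Fin N → ι)
    {w : Fin N → Fin N → ℝ} (hw0 : ∀ x y, 0 ≤ w x y) (hw1 : ∀ x y, w x y ≤ 1)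
    (hws : ∀ x y, w x y = w y x) {C : ℝ} (hC1 : 1 ≤ C) (hC : ∀ y, ∑ x, w x y ≤ C)
    {σ : ℝ} (hσ : 0 ≤ σ)
    (hcov : ∀ a b x y, |∫ ω, W (g a x) ω * W (g b y) ω ∂P| ≤ σ ^ 2 * w x y)
    (s : Finset A) (U : Finset V) (Φ : (V → Fin N) → ℝ) (hΦ : ∀ j, 0 ≤ Φ j)
    (hΦU : ∀ u ∉ U, ∀ j x, Φ (Function.update j u x) = Φ j)
    (hodd : ∀ u ∉ U, Odd (s.filter (fun a ↦ v a = u)).card) :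
    ∑ j, Φ j * |∫ ω, ∏ a ∈ s, W (g a (j (v a))) ω ∂P|
      ≤ (s.card.factorial * σ ^ s.card) * ((C / √N) ^ (Uᶜ).card * ∑ j, Φ j) := by
  have := hW.isProbabilityMeasure
  have hN' : (0 : ℝ) < N := by exact_mod_cast hN
  have hR0 : 0 ≤ C / √N := by positivity
  have hCR2 : C / N ≤ (C / √N) ^ 2 := by
    rw [div_pow, Real.sq_sqrt hN'.le]
    gcongr
    nlinarith
  have hCR1 : C / N ≤ (C / √N) ^ 1 := by
    rw [pow_one]
    gcongr
    rw [Real.sqrt_le_left hN'.le]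
    have : (1 : ℝ) ≤ N := by exact_mod_cast hN
    nlinarith
  induction hk : s.card using Nat.strong_induction_on generalizing s U Φ with
  | _ k ih =>
  rcases s.eq_empty_or_nonempty with rfl | ⟨a, ha⟩
  · have hU : Uᶜ = ∅ := by
      rw [Finset.compl_eq_empty_iff, Finset.eq_univ_iff_forall]
      intro u
      by_contra hu
      simpa using hodd u hu
    simp [← hk, hU]
  -- the half-edge `a` is paired with each of the remaining ones in turn
  have hpair (b : A) (hb : b ∈ s.erase a) :
      ∑ j, Φ j * w (j (v a)) (j (v b)) *
          |∫ ω, ∏ b' ∈ (s.erase a).erase b, W (g b' (j (v b'))) ω ∂P|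
        ≤ ((k - 2).factorial * σ ^ (k - 2)) * ((C / √N) ^ (Uᶜ).card * ∑ j, Φ j) := by
    have hcard : ((s.erase a).erase b).card = k - 2 := by
      rw [Finset.card_erase_of_mem hb, Finset.card_erase_of_mem ha, hk]
      rfl
    have hk0 : 0 < k := hk ▸ Finset.card_pos.2 ⟨a, ha⟩
    have hfilter (u : V) (hua : v a ≠ u) (hub : v b ≠ u) :
        ((s.erase a).erase b).filter (fun a ↦ v a = u) = s.filter (fun a ↦ v a = u) := by
      ext c
      simp only [Finset.mem_filter, Finset.mem_erase]
      grind
    have hle : ∑ j, Φ j * w (j (v a)) (j (v b)) ≤ ∑ j, Φ j :=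
      Finset.sum_le_sum fun j _ ↦ mul_le_of_le_one_right (hΦ j) (hw1 _ _)
    by_cases hab : v a = v b
    · -- a pairing inside one vertex changes neither the weight nor the parity
      refine (Finset.sum_le_sum fun j _ ↦ mul_le_mul_of_nonneg_right
        (mul_le_of_le_one_right (hΦ j) (hw1 _ _)) (abs_nonneg _)).trans
        (ih (k - 2) (by omega) _ U Φ hΦ hΦU (fun u hu ↦ ?_) hcard)
      have hu' := hodd u hu
      by_cases hau : v a = u
      · have ha' : a ∈ s.filter (fun a ↦ v a = u) := by simp [ha, hau]
        have hb' : b ∈ (s.filter (fun a ↦ v a = u)).erase a := by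
          have := Finset.mem_erase.1 hb
          simp [this.1, this.2, ← hab, hau]
        have h1 : (s.filter (fun a ↦ v a = u)).card
            = (((s.erase a).erase b).filter (fun a ↦ v a = u)).card + 2 := by
          rw [Finset.filter_erase, Finset.filter_erase, Finset.card_erase_of_mem hb',
            Finset.card_erase_of_mem ha']
          have h2 := Finset.card_pos.2 ⟨b, hb'⟩
          rw [Finset.card_erase_of_mem ha'] at h2
          omega
        rw [h1] at hu'
        simpa [Nat.odd_add] using hu'
      · rwa [hfilter u hau (hab ▸ hau)]
    set U' : Finset V := insert (v a) (insert (v b) U) with hU'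
    have hUU' : U ⊆ U' := fun u hu ↦ by simp [hU', hu]
    refine (ih (k - 2) (by omega) _ U' (fun j ↦ Φ j * w (j (v a)) (j (v b)))
      (fun j ↦ mul_nonneg (hΦ j) (hw0 _ _)) (fun u hu j x ↦ ?_) (fun u hu ↦ ?_) hcard).trans ?_
    · simp only [hU', Finset.mem_insert, not_or] at hu
      simp only [hΦU u hu.2.2, Function.update_of_ne (Ne.symm hu.1),
        Function.update_of_ne (Ne.symm hu.2.1)]
    · have hu' := hodd u fun h ↦ hu (hUU' h)
      simp only [hU', Finset.mem_insert, not_or] at hu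
      rwa [hfilter u (Ne.symm hu.1) (Ne.symm hu.2.1)]
    refine mul_le_mul_of_nonneg_left ?_ (by positivity)
    have hS : 0 ≤ ∑ j, Φ j := Finset.sum_nonneg fun j _ ↦ hΦ j
    by_cases hUeq : U' = U
    · rw [hUeq]
      gcongr
    have hgain : ∑ j, Φ j * w (j (v a)) (j (v b)) ≤ C / N * ∑ j, Φ j := by
      by_cases hva : v a ∈ U
      · have hvb : v b ∉ U := fun hvb ↦ hUeq (by simp [hU', hva, hvb])
        refine le_of_eq_of_le (Finset.sum_congr rfl fun j _ ↦ ?_)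
          (sum_mul_kernel_le hΦ (hΦU _ hvb) (Ne.symm hab) hC hN)
        rw [hws]
      · exact sum_mul_kernel_le hΦ (hΦU _ hva) hab hC hN
    obtain ⟨e, he, hCe⟩ : ∃ e, (Uᶜ).card = (U'ᶜ).card + e ∧ C / N ≤ (C / √N) ^ e := by
      have h1 := Finset.card_compl_add_card U
      have h2 := Finset.card_compl_add_card U'
      have h3 : U'.card ≤ U.card + 2 :=
        (Finset.card_insert_le _ _).trans (by grind [Finset.card_insert_le])
      have h4 : U.card < U'.card := Finset.card_lt_card (hUU'.ssubset_of_ne (Ne.symm hUeq))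
      have h5 : U'.card = U.card + 1 ∨ U'.card = U.card + 2 := by omega
      rcases h5 with h5 | h5
      · exact ⟨1, by omega, hCR1⟩
      · exact ⟨2, by omega, hCR2⟩
    rw [he, pow_add, mul_assoc]
    refine mul_le_mul_of_nonneg_left (hgain.trans ?_) (by positivity)
    exact mul_le_mul_of_nonneg_right hCe hS
  set B : ℝ := (C / √N) ^ (Uᶜ).card * ∑ j, Φ j
  have hB : 0 ≤ B := mul_nonneg (by positivity) (Finset.sum_nonneg fun j _ ↦ hΦ j)
  have hwick (j : V → Fin N) : Φ j * |∫ ω, ∏ a ∈ s, W (g a (j (v a))) ω ∂P|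
      ≤ ∑ b ∈ s.erase a, σ ^ 2 * (Φ j * w (j (v a)) (j (v b)) *
          |∫ ω, ∏ b' ∈ (s.erase a).erase b, W (g b' (j (v b'))) ω ∂P|) := by
    simp only [← Finset.mul_prod_erase s _ ha]
    rw [integral_mul_prod_of_isGaussianProcess hW h0 (g a (j (v a))) (fun b ↦ g b (j (v b)))]
    refine (mul_le_mul_of_nonneg_left (Finset.abs_sum_le_sum_abs _ _) (hΦ j)).trans ?_
    rw [Finset.mul_sum]
    refine Finset.sum_le_sum fun b _ ↦ ?_
    rw [abs_mul]
    calc _ ≤ Φ j * ((σ ^ 2 * w (j (v a)) (j (v b))) * _) := by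
            gcongr
            · exact hΦ j
            · exact hcov _ _ _ _
      _ = _ := by ring
  calc _ ≤ ∑ j, ∑ b ∈ s.erase a, σ ^ 2 * (Φ j * w (j (v a)) (j (v b)) *
          |∫ ω, ∏ b' ∈ (s.erase a).erase b, W (g b' (j (v b'))) ω ∂P|) :=
        Finset.sum_le_sum fun j _ ↦ hwick j
    _ ≤ ∑ b ∈ s.erase a, σ ^ 2 * (((k - 2).factorial * σ ^ (k - 2)) * B) := by
        rw [Finset.sum_comm]
        refine Finset.sum_le_sum fun b hb ↦ ?_
        rw [← Finset.mul_sum]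
        exact mul_le_mul_of_nonneg_left (hpair b hb) (by positivity)
    _ ≤ _ := by
        rw [Finset.sum_const, Finset.card_erase_of_mem ha, hk, nsmul_eq_mul]
        rcases k with _ | _ | k
        · simp at hk
          simp [hk] at ha
        · simp
          positivity
        · simp only [Nat.add_sub_cancel, Nat.factorial_succ]
          push_cast
          have hD : 0 ≤ ((k : ℝ) + 1) * k.factorial * σ ^ (k + 2) * B := by positivity
          calc _ = 1 * (((k : ℝ) + 1) * k.factorial * σ ^ (k + 2) * B) := by ring
            _ ≤ ((k : ℝ) + 2) * (((k : ℝ) + 1) * k.factorial * σ ^ (k + 2) * B) := by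
              gcongr
              linarith
            _ = _ := by ring

/-- The moment bound for sums of `N` products of three centered jointly Gaussian variables whose
covariances have row sums bounded by `C * σ ^ 2`. The growth `N ^ m` in place of `N ^ (2 * m)` is
the cancellation that comes from the odd number of factors. -/
theorem integral_sum_prod_three_pow_le {Ω ι : Type*} [MeasurableSpace Ω] {P : Measure Ω}
    {W : ι → Ω → ℝ} (hW : IsGaussianProcess W P) (h0 : ∀ i, ∫ ω, W i ω ∂P = 0) (hN : 0 < N)
    (g : Fin 3 → Fin N → ι)
    {w : Fin N → Fin N → ℝ} (hw0 : ∀ x y, 0 ≤ w x y) (hw1 : ∀ x y, w x y ≤ 1)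
    (hws : ∀ x y, w x y = w y x) {C : ℝ} (hC1 : 1 ≤ C) (hC : ∀ y, ∑ x, w x y ≤ C)
    {σ : ℝ} (hσ : 0 ≤ σ)
    (hcov : ∀ a b x y, |∫ ω, W (g a x) ω * W (g b y) ω ∂P| ≤ σ ^ 2 * w x y) (m : ℕ) :
    Integrable (fun ω ↦ (∑ x, ∏ q, W (g q x) ω) ^ (2 * m)) P ∧
    ∫ ω, (∑ x, ∏ q, W (g q x) ω) ^ (2 * m) ∂P
      ≤ ((6 * m).factorial * C ^ (2 * m)) * (σ ^ (6 * m) * N ^ m) := by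
  have hN' : (0 : ℝ) < N := by exact_mod_cast hN
  have hexp (ω : Ω) : (∑ x, ∏ q, W (g q x) ω) ^ (2 * m)
      = ∑ j : Fin (2 * m) → Fin N, ∏ a : Fin (2 * m) × Fin 3, W (g a.2 (j a.1)) ω := by
    rw [Fintype.sum_pow]
    simp only [Fintype.prod_prod_type]
  have hint (j : Fin (2 * m) → Fin N) :
      Integrable (fun ω ↦ ∏ a : Fin (2 * m) × Fin 3, W (g a.2 (j a.1)) ω) P :=
    integrable_prod_of_isGaussianProcess hW (fun a : Fin (2 * m) × Fin 3 ↦ g a.2 (j a.1)) _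
  simp only [hexp]
  refine ⟨integrable_finsetSum _ fun j _ ↦ hint j, ?_⟩
  rw [integral_finsetSum _ fun j _ ↦ hint j]
  have key := sum_mul_abs_integral_prod_le hW h0 hN (fun a : Fin (2 * m) × Fin 3 ↦ a.1)
    (fun a x ↦ g a.2 x) hw0 hw1 hws hC1 hC hσ (fun a b ↦ hcov a.2 b.2) Finset.univ ∅ (fun _ ↦ 1)
    (fun _ ↦ zero_le_one) (fun _ _ _ _ ↦ rfl) (fun u _ ↦ by
      have : Finset.univ.filter (fun a : Fin (2 * m) × Fin 3 ↦ a.1 = u)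
          = {u} ×ˢ (Finset.univ : Finset (Fin 3)) := by
        ext ⟨p, q⟩
        simp [eq_comm]
      rw [this, Finset.card_product]
      simp only [Finset.card_singleton, Finset.card_univ, Fintype.card_fin]
      decide)
  refine (Finset.sum_le_sum fun j _ ↦ le_abs_self _).trans ?_
  simp only [one_mul] at key
  refine key.trans (le_of_eq ?_)
  have h6 : 2 * m * 3 = 6 * m := by ring
  simp only [Finset.card_univ, Fintype.card_prod, Fintype.card_fin, Finset.compl_empty, h6,
    Finset.sum_const, nsmul_eq_mul, mul_one, Fintype.card_fun]
  have h7 : (√(N : ℝ)) ^ (2 * m) = N ^ m := by rw [pow_mul, Real.sq_sqrt hN'.le]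
  rw [div_pow, h7]
  push_cast
  field_simp
  ring

end Counting

/-! ### Covariances of the increments of fractional Brownian motion -/

section FractionalNoise

/-- The increment `(r + 1) ^ (2H) - r ^ (2H)`. -/
noncomputable def rpowStep (H : ℝ) (r : ℕ) : ℝ := ((r + 1 : ℕ) : ℝ) ^ (2 * H) - (r : ℝ) ^ (2 * H)

theorem rpowStep_nonneg {H : ℝ} (hH : 0 < H) (r : ℕ) : 0 ≤ rpowStep H r := by
  refine sub_nonneg.2 (Real.rpow_le_rpow (by positivity) ?_ (by positivity))
  push_cast
  linarith

theorem rpowStep_zero {H : ℝ} (hH : 0 < H) : rpowStep H 0 = 1 := by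
  have : 2 * H ≠ 0 := by positivity
  simp [rpowStep, Real.zero_rpow this]

/-- The steps decrease because `x ↦ x ^ (2H)` is concave for `2H ≤ 1`. -/
theorem rpowStep_succ_le {H : ℝ} (hH : 0 < H) (hH' : H < 1 / 2) (r : ℕ) :
    rpowStep H (r + 1) ≤ rpowStep H r := by
  have hc := (Real.concaveOn_rpow (show 0 ≤ 2 * H by linarith) (by linarith)).2
    (show (r : ℝ) ∈ Set.Ici 0 from Set.mem_Ici.2 (Nat.cast_nonneg r))
    (show ((r + 2 : ℕ) : ℝ) ∈ Set.Ici 0 from Set.mem_Ici.2 (Nat.cast_nonneg _))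
    (show (0 : ℝ) ≤ 1 / 2 by norm_num) (show (0 : ℝ) ≤ 1 / 2 by norm_num) (by norm_num)
  have h1 : (1 / 2 : ℝ) • (r : ℝ) + (1 / 2 : ℝ) • ((r + 2 : ℕ) : ℝ) = ((r + 1 : ℕ) : ℝ) := by
    push_cast
    simp only [smul_eq_mul]
    ring
  rw [h1] at hc
  simp only [smul_eq_mul] at hc
  simp only [rpowStep]
  have h2 : r + 1 + 1 = r + 2 := rfl
  rw [h2]
  linarith

/-- The absolute value of the covariance of two increments of a fractional Brownian motion with
`H ≤ 1 / 2` over intervals of length one at distance `r`. -/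
noncomputable def noiseKernel (H : ℝ) : ℕ → ℝ
  | 0 => 1
  | r + 1 => (rpowStep H r - rpowStep H (r + 1)) / 2

theorem noiseKernel_nonneg {H : ℝ} (hH : 0 < H) (hH' : H < 1 / 2) (r : ℕ) :
    0 ≤ noiseKernel H r := by
  cases r with
  | zero => exact zero_le_one
  | succ r => exact div_nonneg (sub_nonneg.2 (rpowStep_succ_le hH hH' r)) zero_le_two

theorem sum_range_noiseKernel_succ_le {H : ℝ} (hH : 0 < H) (R : ℕ) :
    ∑ r ∈ Finset.range R, noiseKernel H (r + 1) ≤ 1 / 2 := by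
  have : ∑ r ∈ Finset.range R, noiseKernel H (r + 1) = (rpowStep H 0 - rpowStep H R) / 2 := by
    simp only [noiseKernel, ← Finset.sum_div, Finset.sum_range_sub']
  rw [this, rpowStep_zero hH]
  linarith [rpowStep_nonneg hH R]

theorem noiseKernel_le_one {H : ℝ} (hH : 0 < H) (hH' : H < 1 / 2) (r : ℕ) :
    noiseKernel H r ≤ 1 := by
  cases r with
  | zero => exact le_rfl
  | succ r =>
    have := (Finset.single_le_sum (fun i _ ↦ noiseKernel_nonneg hH hH' (i + 1))
      (Finset.self_mem_range_succ r)).trans (sum_range_noiseKernel_succ_le hH (r + 1))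
    linarith

theorem sum_noiseKernel_dist_le {H : ℝ} (hH : 0 < H) {N : ℕ} (y : Fin N) :
    ∑ x : Fin N, noiseKernel H (Nat.dist x y) ≤ 2 := by
  rw [Fin.sum_univ_eq_sum_range (fun x ↦ noiseKernel H (Nat.dist x y)) N, Finset.range_eq_Ico,
    ← Finset.sum_Ico_consecutive _ (Nat.zero_le _) y.2.le, ← Finset.range_eq_Ico,
    Finset.sum_Ico_eq_sum_range, ← Finset.sum_range_reflect]
  have h1 : ∑ x ∈ Finset.range (y : ℕ), noiseKernel H (Nat.dist (y - 1 - x) y) ≤ 1 / 2 := by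
    refine le_of_eq_of_le (Finset.sum_congr rfl fun x hx ↦ ?_) (sum_range_noiseKernel_succ_le hH y)
    congr 1
    have := Finset.mem_range.1 hx
    simp only [Nat.dist]
    omega
  have h2 : ∑ x ∈ Finset.range (N - y), noiseKernel H (Nat.dist (y + x) y) ≤ 1 + 1 / 2 := by
    obtain ⟨R, hR⟩ : ∃ R, N - (y : ℕ) = R + 1 := ⟨N - y - 1, by omega⟩
    rw [hR, Finset.sum_range_succ', add_comm]
    refine add_le_add (by simp [noiseKernel]) ?_
    refine le_of_eq_of_le (Finset.sum_congr rfl fun x hx ↦ ?_) (sum_range_noiseKernel_succ_le hH R)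
    congr 1
    simp only [Nat.dist]
    omega
  linarith

/-- The covariance of increments over grid intervals of unit length has absolute value
`noiseKernel`. -/
theorem abs_noise_covariance {H : ℝ} (hH : 0 < H) (hH' : H < 1 / 2) (x y : ℕ) :
    |(|(x : ℝ) + 1 - y| ^ (2 * H) + |(x : ℝ) - (y + 1)| ^ (2 * H)
      - |(x : ℝ) + 1 - (y + 1)| ^ (2 * H) - |(x : ℝ) - y| ^ (2 * H)) / 2|
      = noiseKernel H (Nat.dist x y) := by
  wlog hxy : y ≤ x generalizing x y
  · rw [Nat.dist_comm, ← this y x (by omega), abs_sub_comm (x : ℝ) y,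
      abs_sub_comm ((x : ℝ) + 1) (y + 1), abs_sub_comm (x : ℝ) (y + 1),
      abs_sub_comm ((x : ℝ) + 1) y, add_comm (|(y : ℝ) - (x + 1)| ^ (2 * H))]
  obtain ⟨r, rfl⟩ := Nat.exists_eq_add_of_le hxy
  have hd : Nat.dist (y + r) y = r := by simp [Nat.dist]
  have h0 : 2 * H ≠ 0 := by positivity
  rw [hd]
  have e1 : |((y + r : ℕ) : ℝ) + 1 - y| = ((r + 1 : ℕ) : ℝ) := by
    rw [← abs_of_nonneg (Nat.cast_nonneg (α := ℝ) (r + 1))]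
    push_cast
    congr 1
    ring
  have e2 : |((y + r : ℕ) : ℝ) + 1 - (y + 1)| = (r : ℝ) := by
    rw [← abs_of_nonneg (Nat.cast_nonneg (α := ℝ) r)]
    push_cast
    congr 1
    ring
  have e3 : |((y + r : ℕ) : ℝ) - y| = (r : ℝ) := by
    rw [← abs_of_nonneg (Nat.cast_nonneg (α := ℝ) r)]
    push_cast
    congr 1
    ring
  rw [e1, e2, e3]
  cases r with
  | zero => norm_num [noiseKernel, Real.zero_rpow h0]
  | succ r =>
    have e4 : |((y + (r + 1) : ℕ) : ℝ) - (y + 1)| = (r : ℝ) := by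
      rw [← abs_of_nonneg (Nat.cast_nonneg (α := ℝ) r)]
      push_cast
      congr 1
      ring
    rw [e4, ← abs_of_nonneg (noiseKernel_nonneg hH hH' (r + 1)), ← abs_neg]
    congr 1
    simp only [noiseKernel, rpowStep]
    ring

end FractionalNoise

section Increments

variable {Ω : Type*} [MeasurableSpace Ω] {P : Measure Ω} {d : ℕ} {H T : ℝ}
  {B : ℝ → Ω → EuclideanSpace ℝ (Fin d)}

theorem IsFBM.coord_isGaussianProcess (hB : IsFBM H T B P) :
    IsGaussianProcess (fun (q : Set.Icc (0 : ℝ) T × Fin d) ω ↦ B q.1 ω q.2) P :=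
  hB.gaussian.of_isGaussianProcess fun q ↦ ⟨{q.1},
    (EuclideanSpace.proj q.2).comp (.proj ⟨q.1, by simp⟩), fun ω ↦ by simp⟩

theorem IsFBM.memLp_two (hB : IsFBM H T B P) {t : ℝ} (ht : t ∈ Set.Icc 0 T) (i : Fin d) :
    MemLp (fun ω ↦ B t ω i) 2 P :=
  (hB.coord_isGaussianProcess.hasGaussianLaw_eval (⟨t, ht⟩, i)).memLp_two

theorem IsFBM.integral_incr_mul_incr (hB : IsFBM H T B P) {a b a' b' : ℝ}
    (ha : a ∈ Set.Icc 0 T) (hb : b ∈ Set.Icc 0 T) (ha' : a' ∈ Set.Icc 0 T)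
    (hb' : b' ∈ Set.Icc 0 T) (i j : Fin d) :
    ∫ ω, (B b ω i - B a ω i) * (B b' ω j - B a' ω j) ∂P
      = if i = j then (|b - a'| ^ (2 * H) + |a - b'| ^ (2 * H) - |b - b'| ^ (2 * H)
        - |a - a'| ^ (2 * H)) / 2 else 0 := by
  have hi {s t : ℝ} (hs : s ∈ Set.Icc 0 T) (ht : t ∈ Set.Icc 0 T) :
      Integrable (fun ω ↦ B s ω i * B t ω j) P :=
    (hB.memLp_two hs i).integrable_mul (hB.memLp_two ht j)
  have h1 : ∫ ω, (B b ω i - B a ω i) * (B b' ω j - B a' ω j) ∂P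
      = ∫ ω, B b ω i * B b' ω j ∂P - ∫ ω, B b ω i * B a' ω j ∂P
        - (∫ ω, B a ω i * B b' ω j ∂P - ∫ ω, B a ω i * B a' ω j ∂P) := by
    rw [← integral_sub (hi hb hb') (hi hb ha'), ← integral_sub (hi ha hb') (hi ha ha'),
      ← integral_sub (by exact (hi hb hb').sub (hi hb ha')) (by exact (hi ha hb').sub (hi ha ha'))]
    congr 1 with ω
    ring
  rw [h1, hB.covariance _ hb _ hb', hB.covariance _ hb _ ha', hB.covariance _ ha _ hb',
    hB.covariance _ ha _ ha']
  split_ifs <;> ring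

theorem gridPoint_mem_Icc (hT : 0 < T) {n k : ℕ} (hk : k ≤ n) :
    gridPoint T n k ∈ Set.Icc 0 T := by
  rcases Nat.eq_zero_or_pos n with rfl | hn
  · simp [gridPoint, stepSize, hT.le]
  have hn' : (0 : ℝ) < n := by exact_mod_cast hn
  have hk' : (k : ℝ) ≤ n := by exact_mod_cast hk
  refine ⟨by unfold gridPoint stepSize; positivity, ?_⟩
  unfold gridPoint stepSize
  rw [mul_div_assoc', div_le_iff₀ hn']
  nlinarith

/-- The increments of the coordinates of `B` over the steps of the grid. -/
noncomputable def gridIncr (T : ℝ) (n : ℕ) (B : ℝ → Ω → EuclideanSpace ℝ (Fin d))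
    (q : Fin d × Fin n) (ω : Ω) : ℝ :=
  B (gridPoint T n (q.2 + 1)) ω q.1 - B (gridPoint T n q.2) ω q.1

theorem IsFBM.gridIncr_isGaussianProcess (hB : IsFBM H T B P) (hT : 0 < T) (n : ℕ) :
    IsGaussianProcess (gridIncr T n B) P := by
  classical
  refine hB.coord_isGaussianProcess.of_isGaussianProcess fun q ↦ ?_
  let a : Set.Icc (0 : ℝ) T × Fin d := (⟨_, gridPoint_mem_Icc hT q.2.2.le⟩, q.1)
  let b : Set.Icc (0 : ℝ) T × Fin d := (⟨_, gridPoint_mem_Icc hT (Nat.succ_le_of_lt q.2.2)⟩, q.1)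
  exact ⟨{a, b}, .proj ⟨b, by simp⟩ - .proj ⟨a, by simp⟩, fun ω ↦ by simp [gridIncr, a, b]⟩

theorem IsFBM.integral_gridIncr [IsProbabilityMeasure P] (hB : IsFBM H T B P) (hT : 0 < T) (n : ℕ)
    (q : Fin d × Fin n) : ∫ ω, gridIncr T n B q ω ∂P = 0 := by
  have ha := gridPoint_mem_Icc hT q.2.2.le
  have hb := gridPoint_mem_Icc hT (Nat.succ_le_of_lt q.2.2)
  unfold gridIncr
  rw [integral_sub ((hB.memLp_two hb _).integrable (by norm_num))
    ((hB.memLp_two ha _).integrable (by norm_num)), hB.centered _ ha, hB.centered _ hb, sub_zero]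

theorem IsFBM.abs_integral_gridIncr_mul_le (hB : IsFBM H T B P) (hH : 0 < H) (hH' : H < 1 / 2)
    (hT : 0 < T) (n : ℕ) (q q' : Fin d × Fin n) :
    |∫ ω, gridIncr T n B q ω * gridIncr T n B q' ω ∂P|
      ≤ ((T / n) ^ H) ^ 2 * noiseKernel H (Nat.dist q.2 q'.2) := by
  have hn : 0 < n := q.2.pos
  have hh : (0 : ℝ) < T / n := by positivity
  have hσ : ((T / n) ^ H) ^ 2 = (T / n) ^ (2 * H) := by
    rw [← Real.rpow_natCast, ← Real.rpow_mul hh.le, mul_comm H]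
    norm_num
  have hscale (z : ℝ) : |T / n * z| ^ (2 * H) = (T / n) ^ (2 * H) * |z| ^ (2 * H) := by
    rw [abs_mul, abs_of_pos hh, Real.mul_rpow hh.le (abs_nonneg _)]
  unfold gridIncr
  rw [hB.integral_incr_mul_incr (gridPoint_mem_Icc hT q.2.2.le)
    (gridPoint_mem_Icc hT (Nat.succ_le_of_lt q.2.2)) (gridPoint_mem_Icc hT q'.2.2.le)
    (gridPoint_mem_Icc hT (Nat.succ_le_of_lt q'.2.2))]
  have hk := noiseKernel_nonneg hH hH' (Nat.dist q.2 q'.2)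
  split_ifs with hij
  · rw [← abs_noise_covariance hH hH', hσ, ← abs_of_pos (Real.rpow_pos_of_pos hh (2 * H)),
      ← abs_mul]
    refine le_of_eq ?_
    congr 1
    rw [mul_div_assoc', mul_sub, mul_sub, mul_add, ← hscale, ← hscale, ← hscale, ← hscale]
    simp only [gridPoint, stepSize]
    push_cast
    ring_nf
  · rw [abs_zero]
    positivity

/-- The moments of the sums of products of three increments: they grow like those of a random walk
with steps of size `h ^ (3H)`. -/
theorem IsFBM.moment_sum_incr_le [IsProbabilityMeasure P] (hB : IsFBM H T B P) (hH : 0 < H)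
    (hH' : H < 1 / 2) (hT : 0 < T) {n k l : ℕ} (hkl : k < l) (hl : l ≤ n) (i : Fin 3 → Fin d)
    (m : ℕ) :
    let S : Ω → ℝ := fun ω ↦ ∑ x ∈ Finset.Ico k l, ∏ q,
      (B (gridPoint T n (x + 1)) ω (i q) - B (gridPoint T n x) ω (i q))
    Integrable (fun ω ↦ S ω ^ (2 * m)) P ∧ ∫ ω, S ω ^ (2 * m) ∂P
      ≤ ((6 * m).factorial * 2 ^ (2 * m)) * (((T / n) ^ H) ^ (6 * m) * ((l - k : ℕ) : ℝ) ^ m) := by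
  intro S
  have hN : 0 < l - k := by omega
  let g : Fin 3 → Fin (l - k) → Fin d × Fin n := fun q x ↦ (i q, ⟨k + x, by omega⟩)
  have hS (ω : Ω) : S ω = ∑ x, ∏ q, gridIncr T n B (g q x) ω := by
    simp only [S, Finset.sum_Ico_eq_sum_range, Finset.sum_range, gridIncr, g]
  simp only [hS]
  refine integral_sum_prod_three_pow_le (hB.gridIncr_isGaussianProcess hT n)
    (hB.integral_gridIncr hT n) hN g (w := fun x y ↦ noiseKernel H (Nat.dist x y))
    (fun x y ↦ noiseKernel_nonneg hH hH' _) (fun x y ↦ noiseKernel_le_one hH hH' _)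
    (fun x y ↦ by rw [Nat.dist_comm]) one_le_two (sum_noiseKernel_dist_le hH) (by positivity)
    (fun a b x y ↦ ?_) m
  have := hB.abs_integral_gridIncr_mul_le hH hH' hT n (g a x) (g b y)
  rwa [show Nat.dist ((g a x).2 : ℕ) ((g b y).2 : ℕ) = Nat.dist x y by
    simp [g, Nat.dist_add_add_left]] at this

end Increments

/-! ### From the grid points to the interval -/

section Deterministic

variable {d : ℕ} {T : ℝ}

/-- A monomial of degree three in the coordinates is a product of three coordinates. -/
theorem exists_prod_pow_eq_prod_three {α : Fin d → ℕ} (hα : ∑ i, α i = 3) :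
    ∃ i : Fin 3 → Fin d, ∀ y : Fin d → ℝ, ∏ j, y j ^ α j = ∏ q, y (i q) := by
  classical
  let M : Multiset (Fin d) := ∑ j, Multiset.replicate (α j) j
  have hM : M.card = 3 := by simp [M, hα]
  obtain ⟨a, b, c, habc⟩ := Multiset.card_eq_three.1 hM
  refine ⟨![a, b, c], fun y ↦ ?_⟩
  have h1 : (M.map y).prod = ∏ j, y j ^ α j := by
    rw [← Multiset.coe_mapAddMonoidHom, map_sum, Multiset.prod_sum]
    simp
  rw [← h1, habc]
  simp [Fin.prod_univ_three, mul_assoc]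

theorem gridPoint_self {n : ℕ} (hn : 1 ≤ n) : gridPoint T n n = T := by
  have hn' : (n : ℝ) ≠ 0 := by positivity
  unfold gridPoint stepSize
  field_simp

/-- Every time belongs to a closed step of the grid, on which the path is given by the linear
formula. -/
theorem exists_step (hT : 0 < T) {n : ℕ} (hn : 1 ≤ n) (b : ℝ → EuclideanSpace ℝ (Fin d))
    (α : Fin d → ℕ) (x₀ : ℝ) {t : ℝ} (ht0 : 0 ≤ t) (htT : t ≤ T) :
    ∃ k < n, gridPoint T n k ≤ t ∧ t ≤ gridPoint T n (k + 1) ∧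
      monomialPath T n b α x₀ t = monomialPath T n b α x₀ (gridPoint T n k)
        + (t - gridPoint T n k) * (stepSize T n)⁻¹ * incrMonomial T n b α k := by
  have hh : 0 < stepSize T n := div_pos hT (by exact_mod_cast hn)
  rcases ht0.eq_or_lt with rfl | ht
  · refine ⟨0, hn, by simp [gridPoint], ?_, by simp [gridPoint]⟩
    simp [gridPoint, hh.le]
  have hc : 0 < ⌈t / stepSize T n⌉₊ := Nat.ceil_pos.2 (by positivity)
  obtain ⟨k, hk⟩ : ∃ k, ⌈t / stepSize T n⌉₊ = k + 1 := ⟨_, (Nat.succ_pred_eq_of_pos hc).symm⟩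
  obtain ⟨h1, h2⟩ := (Nat.ceil_eq_iff (by omega)).1 hk
  rw [Nat.add_sub_cancel, lt_div_iff₀ hh] at h1
  rw [div_le_iff₀ hh] at h2
  refine ⟨k, ?_, h1.le, h2, monomialPath_eq hT hn b α x₀ k t ⟨h1, h2⟩⟩
  have h3 : gridPoint T n k < gridPoint T n n := by
    rw [gridPoint_self hn]
    exact h1.trans_le htT
  exact_mod_cast lt_of_mul_lt_mul_right h3 hh.le

/-- A Hölder bound for the grid increments of the piecewise linear path extends to the whole
interval, at the cost of a factor three: two times in different steps are joined through the
grid points between them. -/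
theorem holderSeminorm_monomialPath_le (hT : 0 < T) {n : ℕ} (hn : 1 ≤ n)
    (b : ℝ → EuclideanSpace ℝ (Fin d)) (α : Fin d → ℕ) (x₀ : ℝ) {β K : ℝ} (hβ : 0 ≤ β)
    (hβ1 : β ≤ 1) (hK : 0 ≤ K)
    (hgrid : ∀ k l : ℕ, k < l → l ≤ n → |∑ x ∈ Finset.Ico k l, incrMonomial T n b α x|
      ≤ K * (((l - k : ℕ) : ℝ) * stepSize T n) ^ β) :
    holderSeminorm T β (monomialPath T n b α x₀) ≤ ENNReal.ofReal (3 * K) := by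
  have hh : 0 < stepSize T n := div_pos hT (by exact_mod_cast hn)
  set h := stepSize T n with hh_def
  set x := monomialPath T n b α x₀ with hx
  -- increments inside one step
  have hlin {k : ℕ} (hk : k < n) {s t : ℝ} (hst : s ≤ t) (hth : t - s ≤ h) :
      |(t - s) * h⁻¹ * incrMonomial T n b α k| ≤ K * (t - s) ^ β := by
    have h1 := hgrid k (k + 1) (Nat.lt_succ_self k) hk
    simp only [Nat.Ico_succ_singleton, Finset.sum_singleton, Nat.add_sub_cancel_left, Nat.cast_one,
      one_mul] at h1
    have h0 : 0 ≤ (t - s) * h⁻¹ := mul_nonneg (sub_nonneg.2 hst) (by positivity)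
    have h2 : (t - s) * h⁻¹ ≤ ((t - s) * h⁻¹) ^ β := by
      have h3 : (t - s) * h⁻¹ ≤ 1 := by
        rw [← div_eq_mul_inv, div_le_one hh]
        exact hth
      exact Real.self_le_rpow_of_le_one h0 h3 hβ1
    rw [abs_mul, abs_of_nonneg h0]
    calc _ ≤ ((t - s) * h⁻¹) ^ β * (K * h ^ β) := by gcongr
      _ = K * (((t - s) * h⁻¹) ^ β * h ^ β) := by ring
      _ = K * (t - s) ^ β := by
        rw [← Real.mul_rpow h0 hh.le, inv_mul_cancel_right₀ hh.ne']
  have hsucc (k : ℕ) : gridPoint T n (k + 1) = gridPoint T n k + h := by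
    simp only [gridPoint, ← hh_def]
    push_cast
    ring
  have hxsucc (k : ℕ) :
      x (gridPoint T n (k + 1)) = x (gridPoint T n k) + incrMonomial T n b α k := by
    simp only [hx, monomialPath_gridPoint hT hn, Finset.sum_range_succ]
    ring
  have key {s t : ℝ} (hs : 0 ≤ s) (hst : s < t) (ht : t ≤ T) :
      |x t - x s| ≤ 3 * K * (t - s) ^ β := by
    obtain ⟨k, hk, hk1, hk2, hk3⟩ := exists_step hT hn b α x₀ hs (hst.le.trans ht)
    obtain ⟨l, hl, hl1, hl2, hl3⟩ := exists_step hT hn b α x₀ (hs.trans hst.le) ht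
    rw [← hx, ← hh_def] at hk3 hl3
    have hpos : 0 ≤ K * (t - s) ^ β := mul_nonneg hK (Real.rpow_nonneg (by linarith) _)
    rcases lt_trichotomy k l with hkl | rfl | hkl
    · have hmid : |x (gridPoint T n l) - x (gridPoint T n (k + 1))| ≤ K * (t - s) ^ β := by
        have h1 : x (gridPoint T n l) - x (gridPoint T n (k + 1))
            = ∑ y ∈ Finset.Ico (k + 1) l, incrMonomial T n b α y := by
          simp only [hx, monomialPath_gridPoint hT hn, Finset.sum_Ico_eq_sub _ hkl]
          ring
        rw [h1]
        rcases (Nat.succ_le_of_lt hkl).eq_or_lt with h2 | h2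
        · rw [← h2]
          simpa using hpos
        · refine (hgrid (k + 1) l h2 hl.le).trans ?_
          gcongr
          rw [Nat.cast_sub h2.le, sub_mul]
          exact sub_le_sub hl1 hk2
      have hleft : |x (gridPoint T n (k + 1)) - x s| ≤ K * (t - s) ^ β := by
        have h1 : x (gridPoint T n (k + 1)) - x s
            = (gridPoint T n (k + 1) - s) * h⁻¹ * incrMonomial T n b α k := by
          rw [hxsucc, hk3, hsucc]
          field_simp
          ring
        rw [h1]
        refine (hlin hk hk2 (by linarith [hsucc k])).trans ?_
        have h2 : gridPoint T n (k + 1) ≤ gridPoint T n l := by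
          simp only [gridPoint]
          gcongr
          exact hkl
        have := sub_nonneg.2 hk2
        gcongr
        linarith
      have hright : |x t - x (gridPoint T n l)| ≤ K * (t - s) ^ β := by
        rw [hl3, add_sub_cancel_left]
        refine (hlin hl hl1 (by linarith [hsucc l])).trans ?_
        have h2 : gridPoint T n (k + 1) ≤ gridPoint T n l := by
          simp only [gridPoint]
          gcongr
          exact hkl
        have := sub_nonneg.2 hl1
        gcongr
        linarith
      calc |x t - x s| = |(x t - x (gridPoint T n l))
            + (x (gridPoint T n l) - x (gridPoint T n (k + 1)))
            + (x (gridPoint T n (k + 1)) - x s)| := by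
              congr 1
              ring
        _ ≤ _ := (abs_add_three _ _ _)
        _ ≤ _ := by linarith
    · have h1 : x t - x s = (t - s) * h⁻¹ * incrMonomial T n b α k := by
        rw [hl3, hk3]
        ring
      rw [h1]
      have := hlin hk hst.le (by linarith [hsucc k])
      linarith
    · have h2 : gridPoint T n (l + 1) ≤ gridPoint T n k := by
        simp only [gridPoint]
        gcongr
        exact hkl
      linarith
  refine iSup_le fun s ↦ iSup_le fun t ↦ iSup_le fun hs ↦ iSup_le fun hst ↦ iSup_le fun ht ↦ ?_
  refine ENNReal.ofReal_le_ofReal ?_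
  have hts : 0 < t - s := sub_pos.2 hst
  rw [abs_of_pos hts, div_le_iff₀ (Real.rpow_pos_of_pos hts β)]
  exact key hs hst ht

end Deterministic

/-! ### The almost sure bound -/

/-- Countably many random variables with summable normalized moments are dominated, up to the
normalization, by one finite random variable. -/
theorem exists_dominating_of_moments {Ω Q : Type*} [MeasurableSpace Ω] {P : Measure Ω} [Countable Q]
    {X : Q → Ω → ℝ} (hX : ∀ q, AEMeasurable (X q) P) {m : ℕ} (hm : m ≠ 0)
    (hi : ∀ q, Integrable (fun ω ↦ X q ω ^ (2 * m)) P) {a c : Q → ℝ} (hc : ∀ q, 0 < c q)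
    (hE : ∀ q, ∫ ω, X q ω ^ (2 * m) ∂P ≤ a q * c q ^ (2 * m))
    (ha : ∑' q, ENNReal.ofReal (a q) ≠ ∞) :
    ∃ G : Ω → ℝ, Measurable G ∧ (∀ ω, 0 < G ω) ∧ ∀ᵐ ω ∂P, ∀ q, |X q ω| ≤ G ω * c q := by
  let Y : Q → Ω → ℝ≥0∞ := fun q ω ↦ ENNReal.ofReal ((X q ω / c q) ^ (2 * m))
  have hYm (q : Q) : AEMeasurable (Y q) P := (((hX q).div_const _).pow_const _).ennreal_ofReal
  have hY (q : Q) : ∫⁻ ω, Y q ω ∂P ≤ ENNReal.ofReal (a q) := by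
    have h1 : Integrable (fun ω ↦ (X q ω / c q) ^ (2 * m)) P := by
      simp only [div_pow]
      exact (hi q).div_const _
    have h2 : ∀ ω, 0 ≤ (X q ω / c q) ^ (2 * m) := fun ω ↦ (even_two_mul m).pow_nonneg _
    rw [← ofReal_integral_eq_lintegral_ofReal h1 (.of_forall h2)]
    refine ENNReal.ofReal_le_ofReal ?_
    simp only [div_pow]
    rw [integral_div, div_le_iff₀ (pow_pos (hc q) _)]
    exact hE q
  set Z : Ω → ℝ≥0∞ := fun ω ↦ ∑' q, Y q ω with hZ
  have hZm : AEMeasurable Z P := AEMeasurable.tsum hYm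
  have hZi : ∫⁻ ω, Z ω ∂P ≠ ∞ := by
    rw [hZ, lintegral_tsum hYm]
    exact ne_top_of_le_ne_top ha (ENNReal.tsum_le_tsum hY)
  refine ⟨fun ω ↦ (hZm.mk Z ω).toReal + 1, hZm.measurable_mk.ennreal_toReal.add_const 1,
    fun ω ↦ by positivity, ?_⟩
  filter_upwards [ae_lt_top' hZm hZi, hZm.ae_eq_mk] with ω hω hmk q
  rw [← hmk, ← div_le_iff₀ (hc q), ← abs_of_pos (hc q), ← abs_div]
  have h1 : (X q ω / c q) ^ (2 * m) ≤ (Z ω).toReal :=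
    (ENNReal.ofReal_le_iff_le_toReal hω.ne).1 (ENNReal.le_tsum q)
  rw [← (even_two_mul m).pow_abs] at h1
  rcases le_total |X q ω / c q| 1 with h2 | h2
  · linarith [ENNReal.toReal_nonneg (a := Z ω)]
  · linarith [le_self_pow₀ h2 (show 2 * m ≠ 0 by omega)]

/-- The index set of the sums over blocks of steps: a grid with `n + 1` steps, three coordinates,
and the first and last grid points of the block. -/
abbrev BlockIndex (d : ℕ) : Type :=
  (n : ℕ) × ((Fin 3 → Fin d) × {p : Fin (n + 2) × Fin (n + 2) // p.1 < p.2})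

theorem tsum_blockIndex_ne_top (d : ℕ) (L : ℝ) :
    ∑' q : BlockIndex d, ENNReal.ofReal (L / ((q.1 + 1 : ℕ) : ℝ) ^ 4) ≠ ∞ := by
  wlog hL : 0 ≤ L generalizing L
  · refine ne_top_of_le_ne_top (this 0 le_rfl) (ENNReal.tsum_le_tsum fun q ↦ ?_)
    exact ENNReal.ofReal_le_ofReal (div_le_div_of_nonneg_right (by linarith) (by positivity))
  rw [ENNReal.tsum_sigma']
  have hsum : Summable fun n : ℕ ↦ 4 * (d : ℝ) ^ 3 * L * (1 / ((n + 1 : ℕ) : ℝ) ^ 2) :=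
    ((summable_nat_add_iff 1).2 (Real.summable_one_div_nat_pow.2 one_lt_two)).mul_left _
  refine ne_top_of_le_ne_top hsum.tsum_ofReal_ne_top (ENNReal.tsum_le_tsum fun n ↦ ?_)
  dsimp only
  rw [tsum_fintype, Finset.sum_const, nsmul_eq_mul, ← ENNReal.ofReal_natCast,
    ← ENNReal.ofReal_mul (Nat.cast_nonneg _)]
  refine ENNReal.ofReal_le_ofReal ?_
  have hcard : ((Finset.univ :
      Finset ((Fin 3 → Fin d) × {p : Fin (n + 2) × Fin (n + 2) // p.1 < p.2})).card : ℝ)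
      ≤ d ^ 3 * (2 * ((n + 1 : ℕ) : ℝ)) ^ 2 := by
    have h1 := Fintype.card_subtype_le (fun p : Fin (n + 2) × Fin (n + 2) ↦ p.1 < p.2)
    rw [Finset.card_univ, Fintype.card_prod, Fintype.card_fun, Fintype.card_fin, Fintype.card_fin]
    rw [Fintype.card_prod, Fintype.card_fin] at h1
    push_cast
    gcongr
    have h2 : (n + 2) * (n + 2) ≤ (2 * (n + 1)) ^ 2 := by nlinarith
    exact_mod_cast h1.trans h2
  have hn : (0 : ℝ) < ((n + 1 : ℕ) : ℝ) := by positivity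
  calc _ ≤ d ^ 3 * (2 * ((n + 1 : ℕ) : ℝ)) ^ 2 * (L / ((n + 1 : ℕ) : ℝ) ^ 4) := by gcongr
    _ = _ := by
      field_simp
      ring

/-- The size `h ^ (3H) * √N` of the sum over a block of `N` steps, compared with its normalization
`(N h) ^ (1/2 - δ) * h ^ (3H - 1/2 - ε)`. The quotient `(N h) ^ δ * h ^ ε` is at most
`T ^ δ * h ^ ε`. -/
theorem scale_pow_le {H T δ ε : ℝ} (hT : 0 < T) (hδ : 0 < δ) {n N : ℕ} (hn : 0 < n) (hN : 0 < N)
    (hNn : N ≤ n) (m : ℕ) (hm : 4 ≤ 2 * m * ε) :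
    ((T / n) ^ H) ^ (6 * m) * (N : ℝ) ^ m ≤ (T ^ δ * T ^ ε) ^ (2 * m) / (n : ℝ) ^ 4
      * ((N * (T / n)) ^ (1 / 2 - δ) * (T / n) ^ (3 * H - 1 / 2 - ε)) ^ (2 * m) := by
  have hn' : (0 : ℝ) < n := by exact_mod_cast hn
  have hN' : (0 : ℝ) < N := by exact_mod_cast hN
  have hNn' : (N : ℝ) ≤ n := by exact_mod_cast hNn
  set h : ℝ := T / n with hh_def
  have hh : 0 < h := by positivity
  set c := (N * h) ^ (1 / 2 - δ) * h ^ (3 * H - 1 / 2 - ε) with hc_def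
  have hc : 0 < c := by positivity
  have h1 : (h ^ H) ^ (6 * m) * (N : ℝ) ^ m = ((h ^ H) ^ 3 * √N) ^ (2 * m) := by
    rw [mul_pow, ← pow_mul, pow_mul (√(N : ℝ)), Real.sq_sqrt hN'.le]
    congr 2
    ring
  have h2 : (h ^ H) ^ 3 * √N = (N * h) ^ δ * h ^ ε * c := by
    have e1 : (h ^ H) ^ 3 = h ^ (3 * H) := by
      rw [← Real.rpow_natCast, ← Real.rpow_mul hh.le]
      norm_num [mul_comm]
    have e2 : (N * h) ^ δ * (N * h) ^ (1 / 2 - δ) = √N * h ^ (1 / 2 : ℝ) := by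
      rw [← Real.rpow_add (by positivity), Real.sqrt_eq_rpow, ← Real.mul_rpow hN'.le hh.le]
      congr 1
      ring
    have e3 : h ^ ε * h ^ (3 * H - 1 / 2 - ε) * h ^ (1 / 2 : ℝ) = h ^ (3 * H) := by
      rw [← Real.rpow_add hh, ← Real.rpow_add hh]
      congr 1
      ring
    calc _ = √N * (h ^ ε * h ^ (3 * H - 1 / 2 - ε) * h ^ (1 / 2 : ℝ)) := by rw [e1, e3, mul_comm]
      _ = (√N * h ^ (1 / 2 : ℝ)) * h ^ ε * h ^ (3 * H - 1 / 2 - ε) := by ring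
      _ = _ := by
        rw [← e2, hc_def]
        ring
  have h3 : (N * h) ^ δ ≤ T ^ δ := by
    refine Real.rpow_le_rpow (by positivity) ?_ hδ.le
    rw [hh_def, mul_div_assoc', div_le_iff₀ hn']
    nlinarith
  have h4 : (n : ℝ) ^ 4 ≤ ((n : ℝ) ^ ε) ^ (2 * m) := by
    rw [← Real.rpow_natCast ((n : ℝ) ^ ε), ← Real.rpow_mul hn'.le, ← Real.rpow_natCast]
    refine Real.rpow_le_rpow_of_exponent_le (by exact_mod_cast hn) ?_
    push_cast
    linarith
  rw [h1, h2]
  calc _ ≤ (T ^ δ * h ^ ε * c) ^ (2 * m) := by gcongr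
    _ = (T ^ δ * T ^ ε) ^ (2 * m) / ((n : ℝ) ^ ε) ^ (2 * m) * c ^ (2 * m) := by
      rw [hh_def, Real.div_rpow hT.le hn'.le]
      simp only [mul_pow, div_pow]
      ring
    _ ≤ _ := by gcongr

/-- The almost sure bound for all the sums over blocks of steps simultaneously. -/
theorem IsFBM.exists_bound_sum_incr {Ω : Type*} [MeasurableSpace Ω] {P : Measure Ω}
    [IsProbabilityMeasure P] {d : ℕ} {H T : ℝ} {B : ℝ → Ω → EuclideanSpace ℝ (Fin d)}
    (hB : IsFBM H T B P) (hH : 0 < H) (hH' : H < 1 / 2) (hT : 0 < T) {δ ε : ℝ} (hδ : 0 < δ)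
    (hε : 0 < ε) :
    ∃ G : Ω → ℝ, Measurable G ∧ (∀ ω, 0 < G ω) ∧ ∀ᵐ ω ∂P, ∀ n : ℕ, 1 ≤ n →
      ∀ i : Fin 3 → Fin d, ∀ k l : ℕ, k < l → l ≤ n →
        |∑ x ∈ Finset.Ico k l, ∏ q,
            (B (gridPoint T n (x + 1)) ω (i q) - B (gridPoint T n x) ω (i q))|
          ≤ G ω * ((((l - k : ℕ) : ℝ) * (T / n)) ^ (1 / 2 - δ)
            * (T / n) ^ (3 * H - 1 / 2 - ε)) := by
  -- the number of moments makes the bounds summable over all blocks of all grids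
  obtain ⟨m, hm⟩ := exists_nat_ge (2 / ε)
  have hmε : 4 ≤ 2 * m * ε := by
    rw [div_le_iff₀ hε] at hm
    linarith
  have hm0 : m ≠ 0 := by
    rintro rfl
    norm_num at hmε
  let X : BlockIndex d → Ω → ℝ := fun q ω ↦
    ∑ x ∈ Finset.Ico (q.2.2.1.1 : ℕ) q.2.2.1.2, ∏ r,
      (B (gridPoint T (q.1 + 1) (x + 1)) ω (q.2.1 r) - B (gridPoint T (q.1 + 1) x) ω (q.2.1 r))
  let c : BlockIndex d → ℝ := fun q ↦
    (((q.2.2.1.2 - q.2.2.1.1 : ℕ) : ℝ) * (T / (q.1 + 1 : ℕ))) ^ (1 / 2 - δ)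
      * (T / (q.1 + 1 : ℕ)) ^ (3 * H - 1 / 2 - ε)
  have hlt (q : BlockIndex d) : (q.2.2.1.1 : ℕ) < q.2.2.1.2 := q.2.2.2
  have hle (q : BlockIndex d) : (q.2.2.1.2 : ℕ) ≤ q.1 + 1 := Nat.lt_succ_iff.1 q.2.2.1.2.2
  set K : ℝ := (6 * m).factorial * 2 ^ (2 * m)
  have hmom (q : BlockIndex d) := hB.moment_sum_incr_le hH hH' hT (hlt q) (hle q) q.2.1 m
  have hXm (q : BlockIndex d) : AEMeasurable (X q) P := by
    refine Finset.aemeasurable_fun_sum _ fun x hx ↦ Finset.aemeasurable_fun_prod _ fun r _ ↦ ?_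
    have hx' : x < q.1 + 1 := (Finset.mem_Ico.1 hx).2.trans_le (hle q)
    exact (hB.gridIncr_isGaussianProcess hT (q.1 + 1)).aemeasurable (q.2.1 r, ⟨x, hx'⟩)
  obtain ⟨G, hGm, hG0, hG⟩ := exists_dominating_of_moments (X := X) (c := c) (m := m)
    (a := fun q ↦ K * (T ^ δ * T ^ ε) ^ (2 * m) / ((q.1 + 1 : ℕ) : ℝ) ^ 4) hXm hm0
    (fun q ↦ (hmom q).1)
    (fun q ↦ by
      have : (0 : ℝ) < ((q.2.2.1.2 - q.2.2.1.1 : ℕ) : ℝ) := by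
        exact_mod_cast Nat.sub_pos_of_lt (hlt q)
      positivity)
    (fun q ↦ by
      refine (hmom q).2.trans ?_
      rw [mul_div_assoc, mul_assoc K]
      refine mul_le_mul_of_nonneg_left ?_ (by positivity)
      exact scale_pow_le hT hδ (Nat.succ_pos _) (Nat.sub_pos_of_lt (hlt q))
        ((Nat.sub_le _ _).trans (hle q)) m hmε)
    (tsum_blockIndex_ne_top d _)
  refine ⟨G, hGm, hG0, ?_⟩
  filter_upwards [hG] with ω hω n hn i k l hkl hl
  obtain ⟨n, rfl⟩ : ∃ n', n = n' + 1 := ⟨n - 1, by omega⟩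
  exact hω ⟨n, i, ⟨(⟨k, by omega⟩, ⟨l, by omega⟩), hkl⟩⟩

end RoughMilstein

theorem proposition1 {Ω : Type*} [MeasurableSpace Ω] (P : Measure Ω) [IsProbabilityMeasure P]
    {d : ℕ} {H T : ℝ} (hH : 1 / 4 < H) (hH' : H < 1 / 2) (hT : 0 < T)
    (B : ℝ → Ω → EuclideanSpace ℝ (Fin d)) (hB : RoughMilstein.IsFBM H T B P)
    (δ : ℝ) (hδ : 0 < δ) (hδ' : δ < 1 / 2)
    (ε : ℝ) (hε : 0 < ε) (hε' : ε < 3 * H - 1 / 2) :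
    ∃ G : Ω → ℝ, Measurable G ∧ (∀ ω, 0 < G ω) ∧
      ∀ᵐ ω ∂P, ∀ n : ℕ, 1 ≤ n → ∀ α : Fin d → ℕ, ∑ i, α i = 3 → ∀ x₀ : ℝ,
        RoughMilstein.holderSeminorm T (1 / 2 - δ)
            (RoughMilstein.monomialPath T n (fun t ↦ B t ω) α x₀)
          ≤ ENNReal.ofReal (G ω * (T / n) ^ (3 * H - 1 / 2 - ε)) := by
  obtain ⟨G, hGm, hG0, hG⟩ := hB.exists_bound_sum_incr (by linarith) hH' hT hδ hε
  refine ⟨fun ω ↦ 3 * G ω, hGm.const_mul 3, fun ω ↦ mul_pos three_pos (hG0 ω), ?_⟩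
  filter_upwards [hG] with ω hω n hn α hα x₀
  obtain ⟨i, hi⟩ := RoughMilstein.exists_prod_pow_eq_prod_three hα
  have hh : (0 : ℝ) < T / n := div_pos hT (by exact_mod_cast hn)
  rw [mul_assoc]
  refine RoughMilstein.holderSeminorm_monomialPath_le hT hn _ α x₀ (by linarith) (by linarith)
    (mul_nonneg (hG0 ω).le (Real.rpow_nonneg hh.le _)) fun k l hkl hl ↦ ?_
  simp only [RoughMilstein.incrMonomial, hi (fun j ↦ B (RoughMilstein.gridPoint T n (_ + 1)) ω j -
    B (RoughMilstein.gridPoint T n _) ω j)]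
  refine (hω n hn i k l hkl hl).trans (le_of_eq ?_)
  simp only [RoughMilstein.stepSize]
  ring
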